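/- Let $q$ be a complex number with $|q|<1$. For complex $x$ and any complex $p$ with $|p|<1$ put $(x;p)_\infty=\prod_{k\ge 0}(1-xp^k)$, and for real $c$ put $$f_c(q)=\sum_{n=0}^{\infty}\frac{q^{n^2}}{(1+cq+q^2)(1+cq^2+q^4)\cdots(1+cq^n+q^{2n})}$$ (the denominator of the $n=0$ term is $1$). Let $a,b$ be real numbers with $a^2+ab+b^2=3$. Then $$(a+1)f_{-a}(q)+(b+1)f_{-b}(q)-(a+b-1)f_{a+b}(q)=3\,\frac{(q^3;q^3)_\infty^2}{(q;q)_\infty}\prod_{n=1}^{\infty}\frac{1}{1+ab(a+b)q^{3n}+q^{6n}},$$ where all the series and infinite products converge and no denominator vanishes. -/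

import Mathlib

/-- The infinite `q`-shifted factorial `(x; q)_∞ = ∏_{k ≥ 0} (1 - x q ^ k)`. -/
noncomputable def qFactorialInf (x q : ℂ) : ℂ :=
  ∏' k : ℕ, (1 - x * q ^ k)

/-- The denominator `(1 + a q + q ^ 2) (1 + a q ^ 2 + q ^ 4) ⋯ (1 + a q ^ n + q ^ (2 n))`,
which is `1` for `n = 0`. -/
noncomputable def thirdOrderDenom (a : ℝ) (q : ℂ) (n : ℕ) : ℂ :=
  ∏ k ∈ Finset.Icc 1 n, (1 + (a : ℂ) * q ^ k + q ^ (2 * k))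

/-- The `n`-th term of the series `f_a(q)`. -/
noncomputable def thirdOrderTerm (a : ℝ) (q : ℂ) (n : ℕ) : ℂ :=
  q ^ (n ^ 2) / thirdOrderDenom a q n

/-- `f_a(q) = ∑_{n ≥ 0} q ^ (n ^ 2) / ((1 + a q + q ^ 2) ⋯ (1 + a q ^ n + q ^ (2 n)))`. -/
noncomputable def thirdOrderF (a : ℝ) (q : ℂ) : ℂ :=
  ∑' n : ℕ, thirdOrderTerm a q n

/-- The factor `1 + a b (a + b) q ^ (3 n) + q ^ (6 n)`. -/
noncomputable def cubicFactor (a b : ℝ) (q : ℂ) (n : ℕ) : ℂ :=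
  1 + ((a * b * (a + b) : ℝ) : ℂ) * q ^ (3 * n) + q ^ (6 * n)

open Filter Topology Finset

/-! The proof uses one Bailey pair relative to `1`: with `α = baileyAlpha t q`, the sum of `α_r /
((q)_{n-r} (q)_{n+r})` over `r` is `1 / quadProd t q n` (`sum_baileyAlpha_mul_baileyKernel`). It is
used in two ways. Letting `n → ∞` gives `∑ α_r = (q)_∞² / quadProdInf t q` (`tsum_baileyAlpha`).
Multiplying by `q^(n²)` and summing over `n`, with the Durfee rectangle identity for the inner sums,
gives `f_{-t}(q) = (q)_∞⁻¹ ∑ q^(r²) α_r` (`thirdOrderF_neg`). Put `c = -(a + b)`. The hypothesis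
says that `a, b, c` are the roots of `y³ - 3y = abc`, that is `2cos θ` and `2cos (θ ± 2π/3)`, so
that `abc = 2cos 3θ`. A partial fraction identity then turns the weighted combination of the three
sequences `q^(r²) α_r`, term by term, into `3 α_r` for the parameter `abc` and base `q³`
(`three_mul_baileyAlpha_cube`). Summing this over `r`, the first use evaluates the right side and
the second identifies the left side. -/

/-- The finite `q`-factorial `(1 - q) (1 - q ^ 2) ⋯ (1 - q ^ n)`. -/
noncomputable def qFact (q : ℂ) (n : ℕ) : ℂ := ∏ k ∈ range n, (1 - q ^ (k + 1))

/-- The quadratic `1 - t x + x ^ 2`. -/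
noncomputable def quad (t : ℝ) (x : ℂ) : ℂ := 1 - t * x + x ^ 2

/-- The product of `1 - t q ^ k + q ^ (2 k)` over `1 ≤ k ≤ n`. -/
noncomputable def quadProd (t : ℝ) (q : ℂ) (n : ℕ) : ℂ := ∏ k ∈ range n, quad t (q ^ (k + 1))

/-- The sequence `α` of the Bailey pair relative to `1` whose `β` is `1 / quadProd t q`. -/
noncomputable def baileyAlpha (t : ℝ) (q : ℂ) (r : ℕ) : ℂ :=
  if r = 0 then 1
  else (-1) ^ r * q ^ (r + 1).choose 2 * (1 + q ^ r) * (2 - t) / quad t (q ^ r)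

/-- The kernel `1 / ((q)_{n-r} (q)_{n+r})` of a Bailey pair relative to `1`. -/
noncomputable def baileyKernel (q : ℂ) (n r : ℕ) : ℂ :=
  if r ≤ n then (qFact q (n - r) * qFact q (n + r))⁻¹ else 0

/-! ### Recurrences and nonvanishing of the finite products. -/

lemma qFact_succ (q : ℂ) (n : ℕ) : qFact q (n + 1) = qFact q n * (1 - q ^ (n + 1)) :=
  prod_range_succ _ _

lemma quadProd_succ (t : ℝ) (q : ℂ) (n : ℕ) :
    quadProd t q (n + 1) = quadProd t q n * quad t (q ^ (n + 1)) :=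
  prod_range_succ _ _

lemma norm_pow_succ_lt_one {q : ℂ} (hq : ‖q‖ < 1) (k : ℕ) : ‖q ^ (k + 1)‖ < 1 := by
  rw [norm_pow]
  exact pow_lt_one₀ (norm_nonneg _) hq k.succ_ne_zero

lemma one_sub_ne_zero_of_norm_lt_one {x : ℂ} (hx : ‖x‖ < 1) : 1 - x ≠ 0 := by
  intro h
  rw [← sub_eq_zero.1 h] at hx
  simp at hx

lemma one_sub_pow_succ_ne_zero {q : ℂ} (hq : ‖q‖ < 1) (k : ℕ) : 1 - q ^ (k + 1) ≠ 0 :=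
  one_sub_ne_zero_of_norm_lt_one (norm_pow_succ_lt_one hq k)

lemma qFact_ne_zero {q : ℂ} (hq : ‖q‖ < 1) (n : ℕ) : qFact q n ≠ 0 :=
  prod_ne_zero_iff.2 fun k _ => one_sub_pow_succ_ne_zero hq k

/-- Writing `t = 2cos θ`, the quadratic splits as `(1 - e^{iθ} x) (1 - e^{-iθ} x)`, whose roots lie
on the unit circle. -/
lemma quad_ne_zero {t : ℝ} (ht : |t| ≤ 2) {x : ℂ} (hx : ‖x‖ < 1) : quad t x ≠ 0 := by
  obtain ⟨h1, h2⟩ := abs_le.1 ht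
  set θ := Real.arccos (t / 2)
  have hcos : Real.cos θ = t / 2 := Real.cos_arccos (by linarith) (by linarith)
  set z := Complex.exp (θ * Complex.I)
  set w := Complex.exp ((-θ : ℝ) * Complex.I)
  have hz : ‖z‖ = 1 := Complex.norm_exp_ofReal_mul_I θ
  have hw : ‖w‖ = 1 := Complex.norm_exp_ofReal_mul_I (-θ)
  have hzw : z * w = 1 := by
    rw [← Complex.exp_add]
    simp
  have hsum : z + w = t := by
    have h : Complex.cos θ = t / 2 := by
      rw [← Complex.ofReal_cos, hcos]
      push_cast
      ring
    have h' : Complex.cos θ = (z + w) / 2 := by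
      simp [Complex.cos, z, w]
    linear_combination 2 * h - 2 * h'
  have hfac : quad t x = (1 - z * x) * (1 - w * x) := by
    unfold quad
    linear_combination x * hsum - x ^ 2 * hzw
  rw [hfac]
  exact mul_ne_zero (one_sub_ne_zero_of_norm_lt_one (by simpa [hz] using hx))
    (one_sub_ne_zero_of_norm_lt_one (by simpa [hw] using hx))

lemma quadProd_ne_zero {t : ℝ} (ht : |t| ≤ 2) {q : ℂ} (hq : ‖q‖ < 1) (n : ℕ) :
    quadProd t q n ≠ 0 :=
  prod_ne_zero_iff.2 fun k _ => quad_ne_zero ht (norm_pow_succ_lt_one hq k)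

/-! ### The finite Bailey pair. -/

lemma baileyKernel_of_add {q : ℂ} (r s : ℕ) :
    baileyKernel q (r + s) r = (qFact q s * qFact q (r + s + r))⁻¹ := by
  simp [baileyKernel]

lemma baileyAlpha_succ (t : ℝ) (q : ℂ) (r : ℕ) :
    baileyAlpha t q (r + 1) = (-1) ^ (r + 1) * (q ^ (r + 1).choose 2 * q ^ (r + 1)) *
      (1 + q ^ (r + 1)) * (2 - t) / quad t (q ^ (r + 1)) := by
  have h : (r + 1 + 1).choose 2 = (r + 1).choose 2 + (r + 1) := by
    rw [Nat.choose_succ_succ' (r + 1) 1, Nat.choose_one_right, add_comm]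
  simp [baileyAlpha, h, pow_add]

/-- A closed form for the partial sums makes the recurrence in `n` provable by induction on the
cut-off `R`. The parameter `s` stands for `n - 1 - R` and avoids natural subtraction. -/
lemma sum_baileyAlpha_telescope {t : ℝ} (ht : |t| ≤ 2) {q : ℂ} (hq : ‖q‖ < 1) (n R s : ℕ)
    (hn : R + s + 1 = n) :
    ∑ r ∈ range (R + 1), (quad t (q ^ n) * (baileyAlpha t q r * baileyKernel q n r) -
        baileyAlpha t q r * baileyKernel q (n - 1) r) =
      q ^ n * (2 - t) * (-1) ^ R * q ^ (R + 1).choose 2 /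
        ((1 - q ^ n) * qFact q s * qFact q (n + R)) := by
  induction R generalizing s with
  | zero =>
    obtain rfl : n = s + 1 := by omega
    have h1 := qFact_ne_zero hq s
    have h2 := one_sub_pow_succ_ne_zero hq s
    simp only [zero_add, sum_range_one, baileyAlpha, baileyKernel, quad, Nat.sub_zero, add_zero,
      Nat.add_sub_cancel, qFact_succ, Nat.zero_le, if_true, pow_zero,
      show Nat.choose 1 2 = 0 from rfl]
    field_simp
    ring
  | succ R ih =>
    rw [sum_range_succ, ih (s + 1) (by omega)]
    obtain rfl : n = (R + 1) + (s + 1) := by omega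
    have e : (R + 1) + (s + 1) - 1 = (R + 1) + s := by omega
    have e2 : R + 1 + (s + 1) + (R + 1) = (R + 1 + s + (R + 1)) + 1 := by omega
    have e3 : R + 1 + (s + 1) + R = R + 1 + s + (R + 1) := by omega
    have h1 := qFact_ne_zero hq s
    have h2 := one_sub_pow_succ_ne_zero hq s
    have h3 := qFact_ne_zero hq (R + 1 + s + (R + 1))
    have h4 := one_sub_pow_succ_ne_zero hq (R + 1 + s + (R + 1))
    have h5 : 1 - q ^ (R + 1 + (s + 1)) ≠ 0 := one_sub_pow_succ_ne_zero hq (R + 1 + s)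
    have h6 := quad_ne_zero ht (norm_pow_succ_lt_one hq R)
    have c : (R + 1 + 1).choose 2 = (R + 1).choose 2 + (R + 1) := by
      rw [Nat.choose_succ_succ' (R + 1) 1, Nat.choose_one_right, add_comm]
    rw [e, baileyKernel_of_add, baileyKernel_of_add, baileyAlpha_succ, e2, e3, qFact_succ,
      qFact_succ, c, pow_add q _ (R + 1)]
    -- In `X = q^(R+1)` and `Y = q^(s+1)` the induction step is an identity of rational functions.
    have p1 : q ^ (R + 1 + s + (R + 1) + 1) = (q ^ (R + 1)) ^ 2 * q ^ (s + 1) := by ring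
    have p2 : q ^ (R + 1 + (s + 1)) = q ^ (R + 1) * q ^ (s + 1) := by ring
    rw [p1] at h4 ⊢
    rw [p2] at h5 ⊢
    rw [pow_succ (-1 : ℂ) R]
    generalize q ^ (R + 1) = X at *
    generalize q ^ (s + 1) = Y at *
    generalize q ^ (R + 1).choose 2 = E at *
    generalize (-1 : ℂ) ^ R = ε at *
    generalize qFact q s = P at *
    generalize qFact q (R + 1 + s + (R + 1)) = Q at *
    clear ih
    have h7 : 1 - X * t + X ^ 2 ≠ 0 := by simpa [quad, mul_comm] using h6
    unfold quad at h6 ⊢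
    generalize (t : ℂ) = t at *
    field_simp
    ring

/-- The telescoped sum with `s = 0` covers all of row `n`; what it leaves over is cancelled by the
extra term `r = n + 1` of row `n + 1`. -/
lemma quad_mul_sum_baileyAlpha {t : ℝ} (ht : |t| ≤ 2) {q : ℂ} (hq : ‖q‖ < 1) (n : ℕ) :
    quad t (q ^ (n + 1)) * ∑ r ∈ range (n + 2), baileyAlpha t q r * baileyKernel q (n + 1) r =
      ∑ r ∈ range (n + 1), baileyAlpha t q r * baileyKernel q n r := by
  have h := sum_baileyAlpha_telescope ht hq (n + 1) n 0 rfl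
  rw [sum_sub_distrib, ← mul_sum, Nat.add_sub_cancel] at h
  rw [sum_range_succ, mul_add, ← sub_eq_zero]
  have h0 : qFact q 0 = 1 := by simp [qFact]
  have hk := baileyKernel_of_add (q := q) (n + 1) 0
  rw [add_zero, h0, ← add_assoc, qFact_succ] at hk
  rw [h0] at h
  have h1 := qFact_ne_zero hq (n + 1 + n)
  have h2 := one_sub_pow_succ_ne_zero hq (n + 1 + n)
  have h3 := one_sub_pow_succ_ne_zero hq n
  have h4 := quad_ne_zero ht (norm_pow_succ_lt_one hq n)
  rw [hk, baileyAlpha_succ]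
  have key : quad t (q ^ (n + 1)) * ((-1) ^ (n + 1) * (q ^ (n + 1).choose 2 * q ^ (n + 1)) *
      (1 + q ^ (n + 1)) * (2 - t) / quad t (q ^ (n + 1)) *
        (1 * (qFact q (n + 1 + n) * (1 - q ^ (n + 1 + n + 1))))⁻¹) =
      -(q ^ (n + 1) * (2 - t) * (-1) ^ n * q ^ (n + 1).choose 2 /
        ((1 - q ^ (n + 1)) * 1 * qFact q (n + 1 + n))) := by
    have p1 : q ^ (n + 1 + n + 1) = (q ^ (n + 1)) ^ 2 := by ring
    rw [p1] at h2 ⊢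
    rw [pow_succ (-1 : ℂ) n]
    generalize q ^ (n + 1) = X at *
    field_simp
    ring
  rw [key]
  linear_combination h

/-- The finite partial fraction expansion of `1 / quadProd t q n`. -/
lemma sum_baileyAlpha_mul_baileyKernel {t : ℝ} (ht : |t| ≤ 2) {q : ℂ} (hq : ‖q‖ < 1) (n : ℕ) :
    ∑ r ∈ range (n + 1), baileyAlpha t q r * baileyKernel q n r = (quadProd t q n)⁻¹ := by
  induction n with
  | zero => simp [baileyAlpha, baileyKernel, quadProd, qFact]
  | succ n ih =>
    rw [quadProd_succ, mul_inv, ← ih, ← quad_mul_sum_baileyAlpha ht hq n]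
    have := quad_ne_zero ht (norm_pow_succ_lt_one hq n)
    field_simp

/-! ### Infinite products and uniform bounds. -/

lemma exists_norm_le_of_tendsto {f : ℕ → ℂ} {l : ℂ} (h : Tendsto f atTop (𝓝 l)) :
    ∃ C : ℝ, 0 < C ∧ ∀ n, ‖f n‖ ≤ C := by
  obtain ⟨C, hC⟩ := h.norm.bddAbove_range
  exact ⟨max C 1, by positivity, fun n => (hC ⟨n, rfl⟩).trans (le_max_left _ _)⟩

lemma summable_norm_pow_succ {q : ℂ} (hq : ‖q‖ < 1) : Summable fun n : ℕ => ‖q ^ (n + 1)‖ := by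
  simpa using (summable_nat_add_iff 1).2 (summable_geometric_of_lt_one (norm_nonneg q) hq)

lemma tendsto_pow_succ_zero {q : ℂ} (hq : ‖q‖ < 1) :
    Tendsto (fun n : ℕ => q ^ (n + 1)) atTop (𝓝 0) :=
  (tendsto_pow_atTop_nhds_zero_of_norm_lt_one hq).comp (tendsto_add_atTop_nat 1)

lemma quad_eq_one_add (t : ℝ) (x : ℂ) : quad t x = 1 + (-t * x + x ^ 2) := by
  unfold quad
  ring

lemma summable_norm_quad_sub_one (t : ℝ) {q : ℂ} (hq : ‖q‖ < 1) :
    Summable fun n : ℕ => ‖-t * q ^ (n + 1) + (q ^ (n + 1)) ^ 2‖ := by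
  refine .of_nonneg_of_le (fun _ => norm_nonneg _) (fun n => ?_)
    ((summable_norm_pow_succ hq).mul_left (|t| + 1))
  refine (norm_add_le _ _).trans ?_
  have h1 : ‖(-t : ℂ) * q ^ (n + 1)‖ = |t| * ‖q ^ (n + 1)‖ := by simp
  have h2 : ‖(q ^ (n + 1)) ^ 2‖ ≤ ‖q ^ (n + 1)‖ := by
    rw [norm_pow _ 2]
    exact pow_le_of_le_one (norm_nonneg _) (norm_pow_succ_lt_one hq n).le two_ne_zero
  linarith

/-- The infinite product `∏ (1 - t q ^ n + q ^ (2 n))` over `n ≥ 1`. -/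
noncomputable def quadProdInf (t : ℝ) (q : ℂ) : ℂ := ∏' n : ℕ, quad t (q ^ (n + 1))

lemma multipliable_quad (t : ℝ) {q : ℂ} (hq : ‖q‖ < 1) :
    Multipliable fun n : ℕ => quad t (q ^ (n + 1)) := by
  simp_rw [quad_eq_one_add]
  exact multipliable_one_add_of_summable (summable_norm_quad_sub_one t hq)

lemma quadProdInf_ne_zero {t : ℝ} (ht : |t| ≤ 2) {q : ℂ} (hq : ‖q‖ < 1) :
    quadProdInf t q ≠ 0 := by
  have h := fun n => quad_ne_zero ht (norm_pow_succ_lt_one hq n)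
  unfold quadProdInf
  simp_rw [quad_eq_one_add] at h ⊢
  exact tprod_one_add_ne_zero_of_summable h (summable_norm_quad_sub_one t hq)

lemma tendsto_quadProd (t : ℝ) {q : ℂ} (hq : ‖q‖ < 1) :
    Tendsto (quadProd t q) atTop (𝓝 (quadProdInf t q)) :=
  (multipliable_quad t hq).hasProd.tendsto_prod_nat

lemma multipliable_one_sub_mul_pow {q : ℂ} (hq : ‖q‖ < 1) :
    Multipliable fun n : ℕ => 1 - q * q ^ n := by
  simp_rw [← pow_succ', sub_eq_add_neg]
  exact multipliable_one_add_of_summable (by simpa using summable_norm_pow_succ hq)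

lemma qFactorialInf_ne_zero {q : ℂ} (hq : ‖q‖ < 1) : qFactorialInf q q ≠ 0 := by
  have h := one_sub_pow_succ_ne_zero hq
  unfold qFactorialInf
  simp_rw [← pow_succ', sub_eq_add_neg] at h ⊢
  exact tprod_one_add_ne_zero_of_summable h (by simpa using summable_norm_pow_succ hq)

lemma tendsto_qFact {q : ℂ} (hq : ‖q‖ < 1) :
    Tendsto (qFact q) atTop (𝓝 (qFactorialInf q q)) := by
  have h := (multipliable_one_sub_mul_pow hq).hasProd.tendsto_prod_nat
  simp_rw [← pow_succ'] at h
  simp only [qFactorialInf, ← pow_succ']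
  exact h

lemma exists_norm_inv_qFact_le {q : ℂ} (hq : ‖q‖ < 1) :
    ∃ C : ℝ, 0 < C ∧ ∀ n, ‖(qFact q n)⁻¹‖ ≤ C :=
  exists_norm_le_of_tendsto ((tendsto_qFact hq).inv₀ (qFactorialInf_ne_zero hq))

lemma exists_norm_baileyKernel_le {q : ℂ} (hq : ‖q‖ < 1) :
    ∃ C : ℝ, 0 < C ∧ ∀ n r, ‖baileyKernel q n r‖ ≤ C := by
  obtain ⟨C, hC0, hC⟩ := exists_norm_inv_qFact_le hq
  refine ⟨C * C, by positivity, fun n r => ?_⟩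
  unfold baileyKernel
  split_ifs
  · rw [mul_inv, norm_mul]
    exact mul_le_mul (hC _) (hC _) (norm_nonneg _) hC0.le
  · simp only [norm_zero]
    positivity

lemma norm_pow_le_norm_pow {q : ℂ} (hq : ‖q‖ < 1) {m n : ℕ} (h : m ≤ n) : ‖q ^ n‖ ≤ ‖q‖ ^ m := by
  rw [norm_pow]
  exact pow_le_pow_of_le_one (norm_nonneg _) hq.le h

lemma exists_norm_baileyAlpha_le (t : ℝ) {q : ℂ} (hq : ‖q‖ < 1) :
    ∃ C : ℝ, 0 < C ∧ ∀ r, ‖baileyAlpha t q r‖ ≤ C * ‖q‖ ^ r := by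
  -- With no bound on `t`, `quad` may vanish at finitely many indices; since `0⁻¹ = 0`, the sequence
  -- still converges and so is bounded.
  have hlim : Tendsto (fun n : ℕ => (1 + q ^ (n + 1)) * (2 - t) * (quad t (q ^ (n + 1)))⁻¹) atTop
      (𝓝 ((1 + 0) * (2 - t) * (quad t 0)⁻¹)) := by
    have h0 := tendsto_pow_succ_zero hq
    have hquad : Tendsto (fun n : ℕ => quad t (q ^ (n + 1))) atTop (𝓝 (quad t 0)) :=
      (tendsto_const_nhds.sub (tendsto_const_nhds.mul h0)).add (h0.pow 2)
    exact ((tendsto_const_nhds.add h0).mul tendsto_const_nhds).mul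
      (hquad.inv₀ (by simp [quad]))
  obtain ⟨C, hC0, hC⟩ := exists_norm_le_of_tendsto hlim
  refine ⟨max C 1, by positivity, fun r => ?_⟩
  cases r with
  | zero => simp [baileyAlpha]
  | succ r =>
    have e : baileyAlpha t q (r + 1) = (-1) ^ (r + 1) *
        ((1 + q ^ (r + 1)) * (2 - t) * (quad t (q ^ (r + 1)))⁻¹) *
          q ^ ((r + 1).choose 2 + (r + 1)) := by
      rw [baileyAlpha_succ, pow_add]
      ring
    rw [e, norm_mul, norm_mul]
    simp only [norm_pow, norm_neg, norm_one, one_pow, one_mul]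
    refine mul_le_mul ((hC r).trans (le_max_left _ _)) ?_ (by positivity) (by positivity)
    exact pow_le_pow_of_le_one (norm_nonneg _) hq.le (by omega)

/-! ### The limit `n → ∞` of the Bailey pair. -/

lemma tsum_baileyAlpha_mul_baileyKernel {t : ℝ} (ht : |t| ≤ 2) {q : ℂ} (hq : ‖q‖ < 1) (n : ℕ) :
    ∑' r, baileyAlpha t q r * baileyKernel q n r = (quadProd t q n)⁻¹ := by
  rw [← sum_baileyAlpha_mul_baileyKernel ht hq, tsum_eq_sum]
  intro r hr
  have : ¬ r ≤ n := by simpa [Nat.lt_succ_iff] using hr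
  simp [baileyKernel, this]

lemma tendsto_baileyKernel {q : ℂ} (hq : ‖q‖ < 1) (r : ℕ) :
    Tendsto (fun n => baileyKernel q n r) atTop
      (𝓝 ((qFactorialInf q q * qFactorialInf q q)⁻¹)) := by
  have h := tendsto_qFact hq
  have h0 := qFactorialInf_ne_zero hq
  refine (((h.comp (tendsto_sub_atTop_nat r)).mul
    (h.comp (tendsto_add_atTop_nat r))).inv₀ (mul_ne_zero h0 h0)).congr' ?_
  filter_upwards [eventually_ge_atTop r] with n hn
  simp [baileyKernel, hn]

/-- The partial fraction expansion of the reciprocal of the infinite product of quadratics. -/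
lemma tsum_baileyAlpha {t : ℝ} (ht : |t| ≤ 2) {q : ℂ} (hq : ‖q‖ < 1) :
    ∑' r, baileyAlpha t q r = qFactorialInf q q ^ 2 * (quadProdInf t q)⁻¹ := by
  obtain ⟨C, hC0, hC⟩ := exists_norm_baileyKernel_le hq
  obtain ⟨B, hB0, hB⟩ := exists_norm_baileyAlpha_le t hq
  have hgeo := summable_geometric_of_lt_one (norm_nonneg q) hq
  have hlim := tendsto_tsum_of_dominated_convergence (𝓕 := atTop)
    (f := fun n r => baileyAlpha t q r * baileyKernel q n r) (hgeo.mul_left (B * C))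
    (fun r => (tendsto_baileyKernel hq r).const_mul (baileyAlpha t q r))
    (Eventually.of_forall fun n r => by
      rw [norm_mul]
      calc ‖baileyAlpha t q r‖ * ‖baileyKernel q n r‖ ≤ B * ‖q‖ ^ r * C :=
            mul_le_mul (hB r) (hC n r) (norm_nonneg _) (by positivity)
        _ = B * C * ‖q‖ ^ r := by ring)
  simp_rw [tsum_baileyAlpha_mul_baileyKernel ht hq] at hlim
  have huniq := tendsto_nhds_unique hlim
    ((tendsto_quadProd t hq).inv₀ (quadProdInf_ne_zero ht hq))
  rw [tsum_mul_right] at huniq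
  have h0 := qFactorialInf_ne_zero hq
  rw [← huniq]
  field_simp

/-! ### The Durfee rectangle identity. -/

/-- The term `q ^ (m ^ 2 + k m) / ((q)_m (q)_{m+k})` of the series in the
Durfee rectangle identity. -/
noncomputable def durfeeTerm (q : ℂ) (k m : ℕ) : ℂ :=
  q ^ (m ^ 2 + k * m) * ((qFact q m)⁻¹ * (qFact q (m + k))⁻¹)

lemma exists_norm_durfeeTerm_le {q : ℂ} (hq : ‖q‖ < 1) :
    ∃ C : ℝ, 0 < C ∧ ∀ k m, ‖durfeeTerm q k m‖ ≤ C * ‖q‖ ^ m := by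
  obtain ⟨C, hC0, hC⟩ := exists_norm_inv_qFact_le hq
  refine ⟨C * C, by positivity, fun k m => ?_⟩
  rw [durfeeTerm, norm_mul, norm_mul, mul_comm]
  exact mul_le_mul (mul_le_mul (hC _) (hC _) (norm_nonneg _) hC0.le)
    (norm_pow_le_norm_pow hq (by nlinarith)) (norm_nonneg _) (by positivity)

lemma summable_durfeeTerm {q : ℂ} (hq : ‖q‖ < 1) (k : ℕ) : Summable (durfeeTerm q k) := by
  obtain ⟨C, hC0, hC⟩ := exists_norm_durfeeTerm_le hq
  exact .of_norm_bounded ((summable_geometric_of_lt_one (norm_nonneg q) hq).mul_left C) (hC k)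

/-- Over the common denominator `(q)_m (q)_{m+k+1}` the numerator is `1 - q^(m+k+1) - q^m`, split as
`(1 - q^m) - q^m q^(k+1)`. -/
lemma durfeeTerm_sub_durfeeTerm_succ {q : ℂ} (hq : ‖q‖ < 1) (k m : ℕ) :
    durfeeTerm q k m - durfeeTerm q (k + 1) m =
      q ^ (m ^ 2 + k * m) * (1 - q ^ m) * ((qFact q m)⁻¹ * (qFact q (m + (k + 1)))⁻¹) -
        q ^ (k + 1) * durfeeTerm q (k + 1) m := by
  have h1 := qFact_ne_zero hq (m + k)
  have h2 := one_sub_pow_succ_ne_zero hq (m + k)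
  have h3 := qFact_ne_zero hq m
  have e : m ^ 2 + (k + 1) * m = m ^ 2 + k * m + m := by ring
  simp only [durfeeTerm, ← add_assoc, qFact_succ, e]
  have p : q ^ (m + k + 1) = q ^ m * q ^ (k + 1) := by ring
  rw [p] at h2 ⊢
  rw [pow_add q _ m]
  generalize q ^ (k + 1) = Y at *
  generalize q ^ m = X at *
  field_simp
  ring

lemma durfeeTerm_shift {q : ℂ} (hq : ‖q‖ < 1) (k m : ℕ) :
    q ^ ((m + 1) ^ 2 + k * (m + 1)) * (1 - q ^ (m + 1)) *
      ((qFact q (m + 1))⁻¹ * (qFact q (m + 1 + (k + 1)))⁻¹) =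
      q ^ (k + 1) * durfeeTerm q (k + 2) m := by
  have h2 := one_sub_pow_succ_ne_zero hq m
  have h3 := qFact_ne_zero hq m
  have e : (m + 1) ^ 2 + k * (m + 1) = (k + 1) + (m ^ 2 + (k + 2) * m) := by ring
  have e2 : m + 1 + (k + 1) = m + (k + 2) := by ring
  rw [durfeeTerm, qFact_succ, e, e2, pow_add q (k + 1)]
  field_simp

/-- The factor `1 - q^m` kills `m = 0` and cancels into `(q)_m`, so shifting `m` produces the sum
with `k + 2`. -/
lemma tsum_durfeeTerm_sub {q : ℂ} (hq : ‖q‖ < 1) (k : ℕ) :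
    ∑' m, durfeeTerm q k m - ∑' m, durfeeTerm q (k + 1) m =
      -q ^ (k + 1) * (∑' m, durfeeTerm q (k + 1) m - ∑' m, durfeeTerm q (k + 2) m) := by
  set g : ℕ → ℂ := fun m =>
    q ^ (m ^ 2 + k * m) * (1 - q ^ m) * ((qFact q m)⁻¹ * (qFact q (m + (k + 1)))⁻¹)
  have hs := summable_durfeeTerm hq
  have hg1 : ∀ m, g (m + 1) = q ^ (k + 1) * durfeeTerm q (k + 2) m := durfeeTerm_shift hq k
  have hg : Summable g := by
    rw [← summable_nat_add_iff 1]
    simp_rw [hg1]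
    exact (hs (k + 2)).mul_left _
  rw [← (hs k).tsum_sub (hs (k + 1))]
  simp_rw [durfeeTerm_sub_durfeeTerm_succ hq]
  rw [hg.tsum_sub ((hs (k + 1)).mul_left _), hg.tsum_eq_zero_add]
  simp_rw [hg1, tsum_mul_left]
  simp only [g]
  simp
  ring

/-- The Durfee rectangle identity. -/
lemma tsum_durfeeTerm {q : ℂ} (hq : ‖q‖ < 1) (k : ℕ) :
    ∑' m, durfeeTerm q k m = (qFactorialInf q q)⁻¹ := by
  obtain ⟨C, hC0, hC⟩ := exists_norm_durfeeTerm_le hq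
  have hgeo := (summable_geometric_of_lt_one (norm_nonneg q) hq).mul_left C
  -- As `k → ∞` only the term `m = 0` survives.
  have hlim : Tendsto (fun k => ∑' m, durfeeTerm q k m) atTop (𝓝 (qFactorialInf q q)⁻¹) := by
    have h := tendsto_tsum_of_dominated_convergence (𝓕 := atTop) (f := durfeeTerm q)
      (g := fun m => if m = 0 then (qFactorialInf q q)⁻¹ else 0) hgeo (fun m => ?_)
      (Eventually.of_forall hC)
    · simpa using h
    · have hinv := ((tendsto_qFact hq).inv₀ (qFactorialInf_ne_zero hq)).comp
        (tendsto_add_atTop_nat m)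
      cases m with
      | zero =>
        refine hinv.congr fun k => ?_
        simp [durfeeTerm, qFact]
      | succ m =>
        have hz : Tendsto (fun k => q ^ ((m + 1) ^ 2 + k * (m + 1))) atTop (𝓝 0) := by
          refine (tendsto_pow_atTop_nhds_zero_of_norm_lt_one hq).comp
            (tendsto_atTop_mono (fun k => ?_) tendsto_id)
          simp only [id]
          nlinarith
        have h := hz.mul (hinv.const_mul (qFact q (m + 1))⁻¹)
        rw [zero_mul] at h
        refine (h.congr fun k => ?_)
        simp [durfeeTerm, add_comm]
  -- Each consecutive difference is at most the next one in norm, as `‖q^(k+1)‖ < 1`, while the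
  -- differences tend to `0`; hence all of them vanish.
  have hd : ∀ k, ∑' m, durfeeTerm q k m = ∑' m, durfeeTerm q (k + 1) m := by
    have hstep : ∀ j k, ‖∑' m, durfeeTerm q k m - ∑' m, durfeeTerm q (k + 1) m‖ ≤
        ‖∑' m, durfeeTerm q (j + k) m - ∑' m, durfeeTerm q (j + k + 1) m‖ := by
      intro j
      induction j with
      | zero => intro k; simp
      | succ j ih =>
        intro k
        rw [tsum_durfeeTerm_sub hq, norm_mul, norm_neg]
        refine (mul_le_of_le_one_left (norm_nonneg _) (norm_pow_succ_lt_one hq k).le).trans ?_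
        have := ih (k + 1)
        rwa [show j + (k + 1) = j + 1 + k by ring] at this
    intro k
    rw [← sub_eq_zero, ← norm_le_zero_iff]
    have hdiff := (hlim.sub (hlim.comp (tendsto_add_atTop_nat 1))).norm
    rw [sub_self, norm_zero] at hdiff
    exact ge_of_tendsto' (hdiff.comp (tendsto_add_atTop_nat k)) fun j => hstep j k
  have hconst : ∀ k, ∑' m, durfeeTerm q k m = ∑' m, durfeeTerm q 0 m := by
    intro k
    induction k with
    | zero => rfl
    | succ k ih => rw [← hd, ih]
  rw [hconst]
  simp_rw [hconst] at hlim
  exact tendsto_nhds_unique tendsto_const_nhds hlim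

/-! ### Bailey's lemma applied to the series `f_{-t}(q)`. -/

lemma thirdOrderDenom_neg (t : ℝ) (q : ℂ) (n : ℕ) :
    thirdOrderDenom (-t) q n = quadProd t q n := by
  induction n with
  | zero => simp [thirdOrderDenom, quadProd]
  | succ n ih =>
    rw [quadProd_succ, ← ih, thirdOrderDenom, thirdOrderDenom,
      prod_Icc_succ_top (by omega), quad]
    push_cast
    ring

lemma summable_thirdOrderTerm_neg {t : ℝ} (ht : |t| ≤ 2) {q : ℂ} (hq : ‖q‖ < 1) :
    Summable (thirdOrderTerm (-t) q) := by
  obtain ⟨C, hC0, hC⟩ :=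
    exists_norm_le_of_tendsto ((tendsto_quadProd t hq).inv₀ (quadProdInf_ne_zero ht hq))
  refine .of_norm_bounded ((summable_geometric_of_lt_one (norm_nonneg q) hq).mul_right C)
    fun n => ?_
  rw [thirdOrderTerm, thirdOrderDenom_neg, div_eq_mul_inv, norm_mul]
  exact mul_le_mul (norm_pow_le_norm_pow hq (by nlinarith)) (hC n) (norm_nonneg _) (by positivity)

/-- Substituting `n = m + r` gives `q^(r²)` times the Durfee sum with `k = 2r`. -/
lemma tsum_pow_sq_mul_baileyKernel {q : ℂ} (hq : ‖q‖ < 1) (r : ℕ) :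
    ∑' n, q ^ n ^ 2 * baileyKernel q n r = q ^ r ^ 2 * (qFactorialInf q q)⁻¹ := by
  have hshift : ∀ m, q ^ (m + r) ^ 2 * baileyKernel q (m + r) r =
      q ^ r ^ 2 * durfeeTerm q (2 * r) m := by
    intro m
    rw [add_comm m r, baileyKernel_of_add, durfeeTerm, mul_inv,
      show r + m + r = m + 2 * r by ring, show (r + m) ^ 2 = r ^ 2 + (m ^ 2 + 2 * r * m) by ring,
      pow_add q (r ^ 2)]
    ring
  have hs : Summable fun m => q ^ (m + r) ^ 2 * baileyKernel q (m + r) r := by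
    simp_rw [hshift]
    exact (summable_durfeeTerm hq _).mul_left _
  have hzero : ∑ n ∈ range r, q ^ n ^ 2 * baileyKernel q n r = 0 :=
    sum_eq_zero fun n hn => by simp [baileyKernel, mem_range.1 hn]
  have hsplit := Summable.sum_add_tsum_nat_add' (f := fun n => q ^ n ^ 2 * baileyKernel q n r) hs
  rw [← hsplit, hzero, zero_add, tsum_congr hshift, tsum_mul_left, tsum_durfeeTerm hq]

lemma summable_pow_sq_mul_baileyAlpha (t : ℝ) {q : ℂ} (hq : ‖q‖ < 1) :
    Summable fun r => q ^ r ^ 2 * baileyAlpha t q r := by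
  obtain ⟨B, hB0, hB⟩ := exists_norm_baileyAlpha_le t hq
  refine .of_norm_bounded ((summable_geometric_of_lt_one (norm_nonneg q) hq).mul_left B)
    fun r => ?_
  rw [norm_mul]
  refine (mul_le_of_le_one_left (norm_nonneg _) ?_).trans (hB r)
  simpa using norm_pow_le_norm_pow hq (Nat.zero_le (r ^ 2))

/-- The Appell–Lerch type expansion of `f_{-t}(q)`. -/
lemma thirdOrderF_neg {t : ℝ} (ht : |t| ≤ 2) {q : ℂ} (hq : ‖q‖ < 1) :
    thirdOrderF (-t) q =
      (∑' r, q ^ r ^ 2 * baileyAlpha t q r) * (qFactorialInf q q)⁻¹ := by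
  obtain ⟨C, hC0, hC⟩ := exists_norm_baileyKernel_le hq
  obtain ⟨B, hB0, hB⟩ := exists_norm_baileyAlpha_le t hq
  have hgeo := summable_geometric_of_lt_one (norm_nonneg q) hq
  -- Absolute summability over pairs, by a product of two geometric series, justifies exchanging the
  -- sums.
  have hsum : Summable (Function.uncurry fun n r : ℕ =>
      q ^ n ^ 2 * (baileyAlpha t q r * baileyKernel q n r)) := by
    refine .of_norm_bounded ((hgeo.mul_of_nonneg hgeo (fun _ => by positivity)
      (fun _ => by positivity)).mul_left (B * C)) ?_
    rintro ⟨n, r⟩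
    simp only [Function.uncurry_apply_pair, norm_mul]
    calc ‖q ^ n ^ 2‖ * (‖baileyAlpha t q r‖ * ‖baileyKernel q n r‖)
        ≤ ‖q‖ ^ n * (B * ‖q‖ ^ r * C) :=
          mul_le_mul (norm_pow_le_norm_pow hq (by nlinarith))
            (mul_le_mul (hB r) (hC n r) (norm_nonneg _) (by positivity)) (by positivity)
            (by positivity)
      _ = B * C * (‖q‖ ^ n * ‖q‖ ^ r) := by ring
  calc thirdOrderF (-t) q
      = ∑' n, ∑' r, q ^ n ^ 2 * (baileyAlpha t q r * baileyKernel q n r) := by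
        refine tsum_congr fun n => ?_
        rw [tsum_mul_left, tsum_baileyAlpha_mul_baileyKernel ht hq, thirdOrderTerm,
          thirdOrderDenom_neg, div_eq_mul_inv]
    _ = ∑' r, ∑' n, q ^ n ^ 2 * (baileyAlpha t q r * baileyKernel q n r) := hsum.tsum_comm.symm
    _ = ∑' r, q ^ r ^ 2 * baileyAlpha t q r * (qFactorialInf q q)⁻¹ := by
        refine tsum_congr fun r => ?_
        simp_rw [mul_left_comm _ (baileyAlpha t q r)]
        rw [tsum_mul_left, tsum_pow_sq_mul_baileyKernel hq]
        ring
    _ = _ := tsum_mul_right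

/-! ### The cubic identity and the conclusion. -/

/-- With `y = x + 1/x`, each factor is `x (y - t)`. Since `a, b, c` have sum `0` and `ab + bc + ca =
-3`, the product is `x³ (y³ - 3y - abc)`, and `y³ - 3y = x³ + 1/x³`. -/
lemma quad_cube {a b : ℝ} (hab : a ^ 2 + a * b + b ^ 2 = 3) (x : ℂ) :
    quad (-(a * b * (a + b))) (x ^ 3) = quad a x * quad b x * quad (-(a + b)) x := by
  have h : (a : ℂ) ^ 2 + a * b + b ^ 2 = 3 := by exact_mod_cast hab
  unfold quad
  push_cast
  linear_combination (x ^ 2 + x ^ 4) * h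

lemma three_mul_baileyAlpha_cube {a b : ℝ} (hab : a ^ 2 + a * b + b ^ 2 = 3) (ha : |a| ≤ 2)
    (hb : |b| ≤ 2) (hc : |-(a + b)| ≤ 2) {q : ℂ} (hq : ‖q‖ < 1) (r : ℕ) :
    ((a : ℂ) + 1) * (q ^ r ^ 2 * baileyAlpha a q r) +
        ((b : ℂ) + 1) * (q ^ r ^ 2 * baileyAlpha b q r) -
        ((a : ℂ) + b - 1) * (q ^ r ^ 2 * baileyAlpha (-(a + b)) q r) =
      3 * baileyAlpha (-(a * b * (a + b))) (q ^ 3) r := by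
  have h : (a : ℂ) ^ 2 + a * b + b ^ 2 = 3 := by exact_mod_cast hab
  cases r with
  | zero =>
    simp [baileyAlpha]
    ring
  | succ r =>
    have h1 := quad_ne_zero ha (norm_pow_succ_lt_one hq r)
    have h2 := quad_ne_zero hb (norm_pow_succ_lt_one hq r)
    have h3 := quad_ne_zero hc (norm_pow_succ_lt_one hq r)
    have hchoose : (r + 1) ^ 2 + (r + 1).choose 2 = 3 * (r + 1).choose 2 + (r + 1) := by
      have h1 := Nat.choose_two_right (r + 1)
      have h2 := Nat.div_mul_cancel (Nat.even_mul_pred_self (r + 1)).two_dvd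
      rw [← h1, Nat.add_sub_cancel] at h2
      linarith
    have hp : (q ^ 3) ^ (r + 1) = (q ^ (r + 1)) ^ 3 := by ring
    have hp2 : q ^ (r + 1) ^ 2 * q ^ (r + 1).choose 2 =
        (q ^ 3) ^ (r + 1).choose 2 * q ^ (r + 1) := by
      rw [← pow_add, hchoose, pow_add, pow_mul]
    have hmul : ∀ t : ℝ, q ^ (r + 1) ^ 2 * baileyAlpha t q (r + 1) =
        (-1) ^ (r + 1) * (q ^ 3) ^ (r + 1).choose 2 * (q ^ (r + 1)) ^ 2 *
          (1 + q ^ (r + 1)) * ((2 - t) / quad t (q ^ (r + 1))) := by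
      intro t
      rw [baileyAlpha_succ, mul_div_assoc', mul_div_assoc']
      congr 1
      linear_combination (-1) ^ (r + 1) * q ^ (r + 1) * (1 + q ^ (r + 1)) * (2 - (t : ℂ)) * hp2
    rw [hmul, hmul, hmul, baileyAlpha_succ, hp, quad_cube hab]
    generalize q ^ (r + 1) = x at *
    generalize (q ^ 3) ^ (r + 1).choose 2 = E at *
    generalize (-1 : ℂ) ^ (r + 1) = ε at *
    -- In `y = x + 1/x`, with `A = abc`, this is `∑ (t + 1)(2 - t)/(y - t) = 3(y - 1)(2 - A)/(y³ -
    -- 3y - A)` over `t = a, b, c`, cleared of denominators. For distinct roots it is a partial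
    -- fraction expansion: `2 - A = (2 - t)(t + 1)²` makes the residue at `t` equal to `(2 - A)/(t +
    -- 1) = (t + 1)(2 - t)`, whence the weights `t + 1`.
    have key : (1 + x) * (((a : ℂ) + 1) * ((2 - a) * (quad b x * quad (-(a + b)) x)) +
        ((b : ℂ) + 1) * ((2 - b) * (quad a x * quad (-(a + b)) x)) -
        ((a : ℂ) + b - 1) * ((2 - (-(a + b) : ℝ)) * (quad a x * quad b x))) =
        3 * x * (1 + x ^ 3) * (2 - (-(a * b * (a + b)) : ℝ)) := by
      unfold quad
      push_cast
      linear_combination (1 + x) * (-2 * (1 + x ^ 4) + 2 * (x + x ^ 3) - 6 * x ^ 2) * h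
    field_simp
    linear_combination ε * E * x ^ 2 * key

lemma abs_le_two_of_sq_add {a b : ℝ} (hab : a ^ 2 + a * b + b ^ 2 = 3) : |a| ≤ 2 :=
  -- The bound comes from `12 = 3a² + (a + 2b)²`.
  abs_le_of_sq_le_sq (by nlinarith [sq_nonneg (a + 2 * b)]) zero_le_two

/-- This is `|2cos 3θ| ≤ 2` for `a = 2cos θ`, in the algebraic form `4 - (a³ - 3a)² = (4 - a²)(a² -
1)²`. -/
lemma abs_mul_mul_add_le_two {a b : ℝ} (hab : a ^ 2 + a * b + b ^ 2 = 3) :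
    |-(a * b * (a + b))| ≤ 2 := by
  have hcube : -(a * b * (a + b)) = a ^ 3 - 3 * a := by linear_combination -a * hab
  rw [hcube]
  refine abs_le_of_sq_le_sq ?_ zero_le_two
  have h : 0 ≤ 4 - a ^ 2 := by nlinarith [sq_nonneg (a + 2 * b)]
  linarith [mul_nonneg h (sq_nonneg (a ^ 2 - 1))]

lemma cubicFactor_eq_quad (a b : ℝ) (q : ℂ) (n : ℕ) :
    cubicFactor a b q n = quad (-(a * b * (a + b))) ((q ^ 3) ^ n) := by
  unfold cubicFactor quad
  push_cast
  ring

/-- The first seven groups of conjuncts say that every series, product and quotient in the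
identity is meaningful; the last conjunct is the identity itself. The product over `n ≥ 1` is
indexed by `n + 1` with `n : ℕ`. -/
theorem mainTheorem2 (a b : ℝ) (hab : a ^ 2 + a * b + b ^ 2 = 3) (q : ℂ) (hq : ‖q‖ < 1) :
    (∀ n : ℕ, thirdOrderDenom (-a) q n ≠ 0 ∧ thirdOrderDenom (-b) q n ≠ 0 ∧
      thirdOrderDenom (a + b) q n ≠ 0) ∧
    (Summable (thirdOrderTerm (-a) q) ∧ Summable (thirdOrderTerm (-b) q) ∧
      Summable (thirdOrderTerm (a + b) q)) ∧
    Multipliable (fun k : ℕ => 1 - q * q ^ k) ∧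
    Multipliable (fun k : ℕ => 1 - q ^ 3 * (q ^ 3) ^ k) ∧
    qFactorialInf q q ≠ 0 ∧
    (∀ n : ℕ, cubicFactor a b q (n + 1) ≠ 0) ∧
    Multipliable (fun n : ℕ => 1 / cubicFactor a b q (n + 1)) ∧
    ((a : ℂ) + 1) * thirdOrderF (-a) q + ((b : ℂ) + 1) * thirdOrderF (-b) q
        - ((a : ℂ) + (b : ℂ) - 1) * thirdOrderF (a + b) q
      = 3 * (qFactorialInf (q ^ 3) (q ^ 3) ^ 2 / qFactorialInf q q)
          * ∏' n : ℕ, 1 / cubicFactor a b q (n + 1) := by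
  have ha := abs_le_two_of_sq_add hab
  have hb : |b| ≤ 2 := abs_le_two_of_sq_add (a := b) (b := a) (by linarith)
  have hc : |-(a + b)| ≤ 2 := abs_le_two_of_sq_add (a := -(a + b)) (b := a) (by linarith)
  have hA := abs_mul_mul_add_le_two hab
  have hq3 : ‖q ^ 3‖ < 1 := norm_pow_succ_lt_one hq 2
  -- The third series becomes `f_{-t}` with `t = -(a + b)`.
  have hneg : a + b = -(-(a + b)) := by ring
  have hprod := quadProdInf_ne_zero hA hq3
  have hinv := (multipliable_quad (-(a * b * (a + b))) hq3).hasProd.inv₀ hprod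
  have hfac : (fun n : ℕ => 1 / cubicFactor a b q (n + 1)) =
      fun n => (quad (-(a * b * (a + b))) ((q ^ 3) ^ (n + 1)))⁻¹ := by
    ext n
    rw [cubicFactor_eq_quad, one_div]
  refine ⟨fun n => ⟨?_, ?_, ?_⟩, ⟨summable_thirdOrderTerm_neg ha hq,
    summable_thirdOrderTerm_neg hb hq, ?_⟩, multipliable_one_sub_mul_pow hq,
    multipliable_one_sub_mul_pow hq3, qFactorialInf_ne_zero hq, fun n => ?_, ?_, ?_⟩
  · rw [thirdOrderDenom_neg]
    exact quadProd_ne_zero ha hq n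
  · rw [thirdOrderDenom_neg]
    exact quadProd_ne_zero hb hq n
  · rw [hneg, thirdOrderDenom_neg]
    exact quadProd_ne_zero hc hq n
  · rw [hneg]
    exact summable_thirdOrderTerm_neg hc hq
  · rw [cubicFactor_eq_quad]
    exact quad_ne_zero hA (norm_pow_succ_lt_one hq3 n)
  · rw [hfac]
    exact hinv.multipliable
  · have hsa := (summable_pow_sq_mul_baileyAlpha a hq).mul_left ((a : ℂ) + 1)
    have hsb := (summable_pow_sq_mul_baileyAlpha b hq).mul_left ((b : ℂ) + 1)
    have hsc := (summable_pow_sq_mul_baileyAlpha (-(a + b)) hq).mul_left ((a : ℂ) + b - 1)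
    have hsum := tsum_congr (L := .unconditional ℕ) (three_mul_baileyAlpha_cube hab ha hb hc hq)
    rw [(hsa.add hsb).tsum_sub hsc, hsa.tsum_add hsb, tsum_mul_left, tsum_mul_left,
      tsum_mul_left, tsum_mul_left, tsum_baileyAlpha hA hq3] at hsum
    have hF := thirdOrderF_neg hc hq
    rw [← hneg] at hF
    rw [hfac, hinv.tprod_eq, ← quadProdInf, thirdOrderF_neg ha hq, thirdOrderF_neg hb hq, hF,
      div_eq_mul_inv]
    linear_combination (qFactorialInf q q)⁻¹ * hsum
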